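/- Let $n\ge 1$, let $x_1,\dots,x_n$ be fixed points of a set $\mathcal X$, and let $Y_i=f(x_i)+\xi_i$, $i=1,\dots,n$, where $f:\mathcal X\to\mathbb R$ and $\xi_1,\dots,\xi_n$ are i.i.d. double exponential with variance $\sigma^2$, $\sigma>0$, i.e. each $\xi_i$ has density $t\mapsto\frac{1}{\sqrt{2\sigma^2}}e^{-\sqrt2|t|/\sigma}$ on $\mathbb R$. Let $(\Lambda,\mathcal A)$ be a measurable space, let $f_\lambda:\mathcal X\to\mathbb R$, $\lambda\in\Lambda$, be functions such that $\lambda\mapsto f_\lambda(x)$ is measurable for every $x\in\mathcal X$, and let $\pi$ be a probability measure on $(\Lambda,\mathcal A)$. Write $\|g\|_n^2=\frac1n\sum_{i=1}^n g(x_i)^2$ and $\|\mathbf Y-g\|_n^2=\frac1n\sum_{i=1}^n(Y_i-g(x_i))^2$ for $g:\mathcal X\to\mathbb R$. For $\beta>0$ let $\hat f_n$ be the exponentially weighted aggregate $$\hat f_n(x)=\int_\Lambda\theta_\lambda(\mathbf Y)f_\lambda(x)\,\pi(d\lambda),\qquad \theta_\lambda(\mathbf Y)=\frac{\exp\{-n\|\mathbf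 Y-f_\lambda\|_n^2/\beta\}}{\int_\Lambda\exp\{-n\|\mathbf Y-f_w\|_n^2/\beta\}\,\pi(dw)}.$$ Assume that $\sup_{\lambda\in\Lambda}\|f-f_\lambda\|_n\le L<\infty$ and $\sup_{i,\lambda}|f_\lambda(x_i)|\le\bar L<\infty$. Then for every $$\beta>\max\Big(\big(8+\tfrac4n\big)\sigma^2+2L^2,\ 4\sigma\big(1+\tfrac1n\big)\bar L\Big),$$ the integrals defining $\hat f_n(x_i)$, $i=1,\dots,n$, converge for all values of $\mathbf Y$, the loss $\|\hat f_n-f\|_n^2$ is integrable, and $$E\big(\|\hat f_n-f\|_n^2\big)\le\int_\Lambda\|f_\lambda-f\|_n^2\,p(d\lambda)+\frac{\beta\,\mathcal K(p,\pi)}{n+1}$$ for every probability measure $p$ on $(\Lambda,\mathcal A)$, where $\mathcal K(p,\pi)\in[0,\infty]$ is the Kullback–Leibler divergence of $p$ from $\pi$ ($\infty$ if $p$ is not absolutely continuous with respect to $\pi$). -/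

import Mathlib

open MeasureTheory ProbabilityTheory InformationTheory
open scoped ENNReal

noncomputable section

namespace ExpAgg

/-- The squared empirical norm of a vector `v` of values at the `n` design points:
`(1/n) ∑ i, v i ^ 2`. -/
def empSq {n : ℕ} (v : Fin n → ℝ) : ℝ := (1 / (n : ℝ)) * ∑ i, v i ^ 2

/-- The exponential weight of the parameter `l` given the observations `y`:
`exp (-n ‖y - f_l‖² / β) / ∫ exp (-n ‖y - f_w‖² / β) π(dw)`. -/
def weight {Λ X : Type*} [MeasurableSpace Λ] {n : ℕ} (x : Fin n → X) (F : Λ → X → ℝ)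
    (π : Measure Λ) (β : ℝ) (y : Fin n → ℝ) (l : Λ) : ℝ :=
  Real.exp (-((n : ℝ) * empSq (fun i => y i - F l (x i))) / β) /
    ∫ w, Real.exp (-((n : ℝ) * empSq (fun i => y i - F w (x i))) / β) ∂π

/-- The exponentially weighted aggregate, as a function of `z`, built from the observations `y`:
`∫ θ_l(y) f_l(z) π(dl)`. -/
def aggregate {Λ X : Type*} [MeasurableSpace Λ] {n : ℕ} (x : Fin n → X) (F : Λ → X → ℝ)
    (π : Measure Λ) (β : ℝ) (y : Fin n → ℝ) (z : X) : ℝ :=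
  ∫ l, weight x F π β y l * F l z ∂π

/-- The centred double exponential density with variance `σ ^ 2`. -/
def doubleExpPDF (σ t : ℝ) : ℝ :=
  1 / Real.sqrt (2 * σ ^ 2) * Real.exp (-(Real.sqrt 2 * |t|) / σ)

/-- The centred double exponential distribution with variance `σ ^ 2` (for `σ > 0`). -/
def doubleExp (σ : ℝ) : Measure ℝ :=
  volume.withDensity fun t => ENNReal.ofReal (doubleExpPDF σ t)

end ExpAgg

end

/-! Put g_l = (f_l(x_i) - f(x_i))_i. After cancelling a factor free of l, the weights are Gibbs
weights proportional to exp((2⟨ξ,g_l⟩ - |g_l|²)/β), and n times the loss is A(ξ), the squared norm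
of the Gibbs mean of g. Let γ = 1/n, and let Φ and Ψ be the log-partition functions with penalties
|g|² and (1+γ)|g|².

The double exponential law is self-decomposable: there is an independent centred ζ with ξ + ζ
distributed as (1+γ)ξ (`doubleExp_conv_dilationNoise`). Hence E Ψ((1+γ)ξ) = E Ψ(ξ+ζ). Given ξ, the
difference Ψ(ξ+ζ) - Φ(ξ) is a log-partition function under the Gibbs measure, and its mean over ζ is
at most -(γ/β) A(ξ) (`integral_logPartition_dilationNoise_le`). This is where β must be large.

So (γ/β) E A ≤ EΦ - EΨ, with Ψ taken at (1+γ)ξ. Jensen gives (1+γ) EΦ ≤ EΨ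
(`mul_log_integral_exp_le`), and Donsker–Varadhan bounds -EΨ by (1+γ)/β ∫|g|² dp + K(p,π), the noise
term being centred. Eliminating EΦ and EΨ yields E A ≤ ∫|g|² dp + β/(1+γ) K(p,π); dividing by n
gives the claim. -/

namespace ExpAgg

/-! ### The double exponential law: transforms and first moment. -/

lemma doubleExpPDF_eq {σ : ℝ} (hσ : 0 < σ) (t : ℝ) :
    doubleExpPDF σ t = √2 / σ / 2 * Real.exp (-(√2 / σ * |t|)) := by
  have h2 : √2 * √2 = 2 := Real.mul_self_sqrt (by norm_num)
  have h : √(2 * σ ^ 2) = √2 * σ := by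
    rw [Real.sqrt_mul (by norm_num), Real.sqrt_sq hσ.le]
  have hs : (√2 : ℝ) ≠ 0 := by positivity
  rw [doubleExpPDF, h]
  congr 1
  · field_simp
    linarith
  · congr 1
    ring

lemma doubleExpPDF_nonneg (σ t : ℝ) : 0 ≤ doubleExpPDF σ t := by
  unfold doubleExpPDF
  positivity

lemma continuous_doubleExpPDF (σ : ℝ) : Continuous (doubleExpPDF σ) := by
  unfold doubleExpPDF
  fun_prop

lemma integral_doubleExp {E : Type*} [NormedAddCommGroup E] [NormedSpace ℝ E] (σ : ℝ)
    (f : ℝ → E) : ∫ t, f t ∂(doubleExp σ) = ∫ t, doubleExpPDF σ t • f t := by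
  rw [doubleExp, integral_withDensity_eq_integral_toReal_smul
    (continuous_doubleExpPDF σ).measurable.ennreal_ofReal (by simp)]
  simp [ENNReal.toReal_ofReal (doubleExpPDF_nonneg σ _)]

lemma integrable_doubleExp_iff {E : Type*} [NormedAddCommGroup E] [NormedSpace ℝ E] (σ : ℝ)
    (f : ℝ → E) :
    Integrable f (doubleExp σ) ↔ Integrable (fun t => doubleExpPDF σ t • f t) := by
  rw [doubleExp, integrable_withDensity_iff_integrable_smul'
    (continuous_doubleExpPDF σ).measurable.ennreal_ofReal (by simp)]
  simp [ENNReal.toReal_ofReal (doubleExpPDF_nonneg σ _)]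

/-- A single complex computation on the strip |Re z| < √2/σ serves for the total mass (z = 0), the
characteristic function (z imaginary) and the moment generating function (z real). On each half-line
the integrand is a pure exponential. -/
lemma integrable_integral_exp_doubleExp {σ : ℝ} (hσ : 0 < σ) {z : ℂ}
    (hz : |z.re| * σ < √2) :
    Integrable (fun t : ℝ => Complex.exp (z * t)) (doubleExp σ) ∧
      ∫ t : ℝ, Complex.exp (z * t) ∂(doubleExp σ) = 1 / (1 - z ^ 2 * σ ^ 2 / 2) := by
  set c : ℝ := √2 / σ with hc
  have hcpos : 0 < c := by positivity
  have hzc : |z.re| < c := by rwa [hc, lt_div_iff₀ hσ]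
  obtain ⟨hz1, hz2⟩ := abs_lt.mp hzc
  have hre1 : (z - c).re < 0 := by simpa using hz2
  have hre2 : 0 < (z + c).re := by simp; linarith
  have eqIoi : Set.EqOn (fun t : ℝ => doubleExpPDF σ t • Complex.exp (z * t))
      (fun t : ℝ => (c / 2 : ℂ) * Complex.exp ((z - c) * t)) (Set.Ioi 0) := by
    intro t ht
    have ht : 0 < t := ht
    simp only [doubleExpPDF_eq hσ, ← hc, abs_of_pos ht, Complex.real_smul]
    push_cast
    rw [mul_assoc, ← Complex.exp_add]
    congr 2
    ring
  have eqIic : Set.EqOn (fun t : ℝ => doubleExpPDF σ t • Complex.exp (z * t))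
      (fun t : ℝ => (c / 2 : ℂ) * Complex.exp ((z + c) * t)) (Set.Iic 0) := by
    intro t ht
    have ht : t ≤ 0 := ht
    simp only [doubleExpPDF_eq hσ, ← hc, abs_of_nonpos ht, Complex.real_smul]
    push_cast
    rw [mul_assoc, ← Complex.exp_add]
    congr 2
    ring
  have i1 : IntegrableOn (fun t : ℝ => doubleExpPDF σ t • Complex.exp (z * t)) (Set.Ioi 0) :=
    (integrableOn_congr_fun eqIoi measurableSet_Ioi).mpr
      ((integrableOn_exp_mul_complex_Ioi hre1 0).const_mul _)
  have i2 : IntegrableOn (fun t : ℝ => doubleExpPDF σ t • Complex.exp (z * t)) (Set.Iic 0) :=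
    (integrableOn_congr_fun eqIic measurableSet_Iic).mpr
      ((integrableOn_exp_mul_complex_Iic hre2 0).const_mul _)
  have n1 : z - c ≠ 0 := fun h => by simp [h] at hre1
  have n2 : z + c ≠ 0 := fun h => by simp [h] at hre2
  refine ⟨?_, ?_⟩
  · rw [integrable_doubleExp_iff, ← integrableOn_univ, ← Set.Iic_union_Ioi (a := (0 : ℝ))]
    exact i2.union i1
  · rw [integral_doubleExp, ← intervalIntegral.integral_Iic_add_Ioi i2 i1,
      setIntegral_congr_fun measurableSet_Ioi eqIoi, setIntegral_congr_fun measurableSet_Iic eqIic,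
      integral_const_mul, integral_const_mul, integral_exp_mul_complex_Ioi hre1,
      integral_exp_mul_complex_Iic hre2]
    have hσc : (σ : ℂ) ≠ 0 := by exact_mod_cast hσ.ne'
    have hc2 : (c : ℂ) ^ 2 * (σ : ℂ) ^ 2 = 2 := by
      have : c ^ 2 * σ ^ 2 = 2 := by
        rw [hc, div_pow, Real.sq_sqrt (by norm_num)]
        field_simp
      exact_mod_cast this
    have hs : (σ : ℂ) ^ 2 = 2 / (c : ℂ) ^ 2 := by
      rw [eq_div_iff (by exact_mod_cast (by positivity : c ^ 2 ≠ 0))]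
      linear_combination hc2
    have hcc : (c : ℂ) ≠ 0 := by exact_mod_cast hcpos.ne'
    have n3 : (c : ℂ) ^ 2 - z ^ 2 ≠ 0 := by
      have : (c : ℂ) ^ 2 - z ^ 2 = -((z - c) * (z + c)) := by ring
      rw [this]
      exact neg_ne_zero.mpr (mul_ne_zero n1 n2)
    have n4 : 1 - z ^ 2 * (2 / (c : ℂ) ^ 2) / 2 ≠ 0 := by
      have : 1 - z ^ 2 * (2 / (c : ℂ) ^ 2) / 2 = (c ^ 2 - z ^ 2) / c ^ 2 := by
        field_simp
      rw [this]
      exact div_ne_zero n3 (pow_ne_zero 2 hcc)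
    rw [hs, eq_div_iff n4]
    simp only [Complex.ofReal_zero, mul_zero, Complex.exp_zero]
    field_simp
    ring

lemma isProbabilityMeasure_doubleExp {σ : ℝ} (hσ : 0 < σ) :
    IsProbabilityMeasure (doubleExp σ) := by
  have h := (integrable_integral_exp_doubleExp hσ (z := 0) (by simp)).2
  simp only [zero_mul, Complex.exp_zero, integral_const] at h
  constructor
  have h' : (doubleExp σ).real Set.univ = 1 := by
    have : (((doubleExp σ).real Set.univ : ℝ) : ℂ) = 1 := by simpa using h
    exact_mod_cast this
  exact (ENNReal.toReal_eq_one_iff _).mp h'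

lemma charFun_doubleExp {σ : ℝ} (hσ : 0 < σ) (t : ℝ) :
    charFun (doubleExp σ) t = 1 / (1 + (t : ℂ) ^ 2 * σ ^ 2 / 2) := by
  rw [charFun_apply_real]
  have h := (integrable_integral_exp_doubleExp hσ (z := t * Complex.I) (by simp)).2
  calc _ = ∫ x : ℝ, Complex.exp (t * Complex.I * x) ∂(doubleExp σ) := by
        congr 1 with x
        congr 1
        ring
    _ = _ := by
        rw [h, mul_pow, Complex.I_sq]
        congr 1
        ring

lemma integrable_exp_mul_doubleExp {σ : ℝ} (hσ : 0 < σ) {t : ℝ} (ht : |t| * σ < √2) :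
    Integrable (fun x => Real.exp (t * x)) (doubleExp σ) := by
  have h := (integrable_integral_exp_doubleExp hσ (z := t) (by simpa using ht)).1.norm
  refine h.congr (.of_forall fun x => ?_)
  simp [Complex.norm_exp]

lemma integral_exp_mul_doubleExp {σ : ℝ} (hσ : 0 < σ) {t : ℝ} (ht : |t| * σ < √2) :
    ∫ x, Real.exp (t * x) ∂(doubleExp σ) = 1 / (1 - t ^ 2 * σ ^ 2 / 2) := by
  have h := (integrable_integral_exp_doubleExp hσ (z := t) (by simpa using ht)).2
  have h' : ((∫ x, Real.exp (t * x) ∂(doubleExp σ) : ℝ) : ℂ) =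
      ((1 / (1 - t ^ 2 * σ ^ 2 / 2) : ℝ) : ℂ) := by
    rw [← integral_complex_ofReal]
    push_cast
    exact h
  exact_mod_cast h'

lemma integrable_exp_mul_abs_doubleExp {σ : ℝ} (hσ : 0 < σ) {t : ℝ} (ht : |t| * σ < √2) :
    Integrable (fun x => Real.exp (t * |x|)) (doubleExp σ) := by
  exact integrable_exp_mul_abs (X := id) (integrable_exp_mul_doubleExp hσ ht)
    (integrable_exp_mul_doubleExp hσ (by rwa [abs_neg]))

lemma integrable_id_doubleExp {σ : ℝ} (hσ : 0 < σ) : Integrable (fun x : ℝ => x) (doubleExp σ) := by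
  have h2 : (0 : ℝ) < 1 / σ := by positivity
  have h := integrable_exp_mul_abs_doubleExp hσ (t := 1 / σ) (by
    rw [abs_of_pos h2, one_div, inv_mul_cancel₀ hσ.ne']
    exact Real.lt_sqrt_of_sq_lt (by norm_num))
  refine (h.const_mul σ).mono' (by fun_prop) (.of_forall fun x => ?_)
  have := Real.add_one_le_exp (1 / σ * |x|)
  rw [Real.norm_eq_abs]
  calc |x| = σ * (1 / σ * |x|) := by field_simp
    _ ≤ _ := by gcongr; linarith

lemma integral_id_doubleExp (σ : ℝ) : ∫ x, x ∂(doubleExp σ) = 0 := by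
  rw [integral_doubleExp]
  have h := integral_neg_eq_self (fun x : ℝ => doubleExpPDF σ x • x) volume
  have h' : ∀ x : ℝ, doubleExpPDF σ (-x) • (-x) = -(doubleExpPDF σ x • x) := by
    intro x
    simp [doubleExpPDF]
  simp only [h', integral_neg] at h
  linarith

/-! ### The dilation noise ζ. -/

/-- The law of a random variable `ζ` such that, for `ξ` double exponential with variance `σ ^ 2`
and independent of `ζ`, the sum `ξ + ζ` is distributed as `(1 + γ) * ξ`. -/
noncomputable def dilationNoise (σ γ : ℝ) : Measure ℝ :=
  ENNReal.ofReal (1 / (1 + γ) ^ 2) • Measure.dirac 0 +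
    ENNReal.ofReal (1 - 1 / (1 + γ) ^ 2) • doubleExp ((1 + γ) * σ)

lemma integral_dilationNoise {E : Type*} [NormedAddCommGroup E] [NormedSpace ℝ E]
    [CompleteSpace E] (σ : ℝ) {γ : ℝ} (hγ : 0 ≤ γ) {h : ℝ → E}
    (hm : Integrable h (doubleExp ((1 + γ) * σ))) :
    ∫ x, h x ∂(dilationNoise σ γ) = (1 / (1 + γ) ^ 2) • h 0 +
      (1 - 1 / (1 + γ) ^ 2) • ∫ x, h x ∂(doubleExp ((1 + γ) * σ)) := by
  have h1 : 1 / (1 + γ) ^ 2 ≤ 1 := by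
    rw [div_le_one (by positivity)]
    nlinarith
  rw [dilationNoise, integral_add_measure, integral_smul_measure, integral_smul_measure,
    integral_dirac, ENNReal.toReal_ofReal (by positivity), ENNReal.toReal_ofReal (by linarith)]
  · exact (integrable_dirac (by simp)).smul_measure ENNReal.ofReal_ne_top
  · exact hm.smul_measure ENNReal.ofReal_ne_top

lemma integrable_dilationNoise {E : Type*} [NormedAddCommGroup E] {σ γ : ℝ} {h : ℝ → E}
    (hm : Integrable h (doubleExp ((1 + γ) * σ))) : Integrable h (dilationNoise σ γ) :=
  ((integrable_dirac (by simp)).smul_measure ENNReal.ofReal_ne_top).add_measure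
    (hm.smul_measure ENNReal.ofReal_ne_top)

lemma isProbabilityMeasure_dilationNoise {σ γ : ℝ} (hσ : 0 < σ) (hγ : 0 ≤ γ) :
    IsProbabilityMeasure (dilationNoise σ γ) := by
  have := isProbabilityMeasure_doubleExp (σ := (1 + γ) * σ) (by positivity)
  have h1 : 1 / (1 + γ) ^ 2 ≤ 1 := by
    rw [div_le_one (by positivity)]
    nlinarith
  constructor
  simp only [dilationNoise, Measure.coe_add, Measure.coe_smul, Pi.add_apply, Pi.smul_apply,
    measure_univ, smul_eq_mul, mul_one]
  rw [← ENNReal.ofReal_add (by positivity) (by linarith)]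
  simp

lemma integral_id_dilationNoise {σ γ : ℝ} (hσ : 0 < σ) (hγ : 0 ≤ γ) :
    ∫ x, x ∂(dilationNoise σ γ) = 0 := by
  rw [integral_dilationNoise σ hγ (integrable_id_doubleExp (by positivity)), integral_id_doubleExp]
  simp

lemma integrable_exp_mul_abs_dilationNoise {σ γ : ℝ} (hσ : 0 < σ) (hγ : 0 ≤ γ) {t : ℝ}
    (ht : |t| * ((1 + γ) * σ) ≤ 1) :
    Integrable (fun x => Real.exp (t * |x|)) (dilationNoise σ γ) :=
  integrable_dilationNoise (integrable_exp_mul_abs_doubleExp (by positivity)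
    (ht.trans_lt (Real.lt_sqrt_of_sq_lt (by norm_num))))

/-- The mixture has transform 1 + (2γ+γ²)σ²t² · (1/2)/D with D = 1 - t²(1+γ)²σ²/2. The restriction
on t forces D ≥ 1/2, and 1 + u ≤ exp u concludes. -/
lemma integral_exp_mul_dilationNoise_le {σ γ : ℝ} (hσ : 0 < σ) (hγ : 0 ≤ γ) {t : ℝ}
    (ht : |t| * ((1 + γ) * σ) ≤ 1) :
    ∫ x, Real.exp (t * x) ∂(dilationNoise σ γ) ≤
      Real.exp ((2 * γ + γ ^ 2) * σ ^ 2 * t ^ 2) := by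
  have hs : 0 < (1 + γ) * σ := by positivity
  have ht' : |t| * ((1 + γ) * σ) < √2 := ht.trans_lt (Real.lt_sqrt_of_sq_lt (by norm_num))
  rw [integral_dilationNoise σ hγ (integrable_exp_mul_doubleExp hs ht'),
    integral_exp_mul_doubleExp hs ht']
  refine le_trans ?_ (Real.add_one_le_exp _)
  have hq : t ^ 2 * ((1 + γ) * σ) ^ 2 ≤ 1 := by
    rw [← mul_pow, ← sq_abs, abs_mul, abs_of_pos hs]
    exact pow_le_one₀ (by positivity) ht
  have hd : (1 : ℝ) / 2 ≤ 1 - t ^ 2 * ((1 + γ) * σ) ^ 2 / 2 := by linarith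
  have hd0 : 0 < 1 - t ^ 2 * ((1 + γ) * σ) ^ 2 / 2 := by linarith
  have key : (1 / (1 + γ) ^ 2) • Real.exp (t * 0) + (1 - 1 / (1 + γ) ^ 2) •
      (1 / (1 - t ^ 2 * ((1 + γ) * σ) ^ 2 / 2)) =
      ((2 * γ + γ ^ 2) * σ ^ 2 * t ^ 2) * (1 / 2 / (1 - t ^ 2 * ((1 + γ) * σ) ^ 2 / 2)) + 1 := by
    simp only [mul_zero, Real.exp_zero, smul_eq_mul]
    generalize hD : 1 - t ^ 2 * ((1 + γ) * σ) ^ 2 / 2 = D at hd0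
    have hT : (1 + γ) ^ 2 * (σ ^ 2 * t ^ 2) = 2 * (1 - D) := by rw [← hD]; ring
    have hne : (1 + γ) ≠ 0 := by positivity
    field_simp
    linear_combination (-(2 * γ + γ ^ 2)) * hT
  rw [key]
  refine add_le_add_left (mul_le_of_le_one_right (by positivity) ?_) 1
  rw [div_le_one hd0]
  exact hd

/-- The characteristic functions of (1+γ)ξ and ξ have ratio A/B with A = 1 + t²σ²/2 and B = 1 +
t²(1+γ)²σ²/2. Its partial fraction decomposition is a constant plus a multiple of 1/B: an atom at 0
mixed with a wider double exponential. -/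
lemma doubleExp_conv_dilationNoise {σ γ : ℝ} (hσ : 0 < σ) (hγ : 0 ≤ γ) :
    doubleExp σ ∗ dilationNoise σ γ = (doubleExp σ).map ((1 + γ) * ·) := by
  have := isProbabilityMeasure_doubleExp hσ
  have := isProbabilityMeasure_dilationNoise hσ hγ
  have hs : 0 < (1 + γ) * σ := by positivity
  have := isProbabilityMeasure_doubleExp hs
  have : IsProbabilityMeasure ((doubleExp σ).map ((1 + γ) * ·)) :=
    Measure.isProbabilityMeasure_map (by fun_prop)
  refine Measure.ext_of_charFun ?_
  ext t
  have hnu : charFun (dilationNoise σ γ) t = (1 / (1 + γ) ^ 2 : ℝ) • (1 : ℂ) +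
      (1 - 1 / (1 + γ) ^ 2 : ℝ) • charFun (doubleExp ((1 + γ) * σ)) t := by
    rw [charFun_apply_real, charFun_apply_real, integral_dilationNoise σ hγ]
    · simp
    · refine (integrable_const (1 : ℝ)).mono' (by fun_prop) (.of_forall fun x => ?_)
      rw [← Complex.ofReal_mul, Complex.norm_exp_ofReal_mul_I]
  rw [charFun_conv, hnu, charFun_map_mul, charFun_doubleExp hσ, charFun_doubleExp hσ,
    charFun_doubleExp hs]
  have e1 : (1 + (t : ℂ) ^ 2 * σ ^ 2 / 2) ≠ 0 := by
    exact_mod_cast (by positivity : (1 + t ^ 2 * σ ^ 2 / 2 : ℝ) ≠ 0)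
  have e2 : (1 + (t : ℂ) ^ 2 * ((1 + γ) * σ) ^ 2 / 2) ≠ 0 := by
    exact_mod_cast (by positivity : (1 + t ^ 2 * ((1 + γ) * σ) ^ 2 / 2 : ℝ) ≠ 0)
  have e3 : (1 + γ : ℂ) ≠ 0 := by
    exact_mod_cast (by positivity : (1 + γ : ℝ) ≠ 0)
  have e4 : (1 + ((1 + γ : ℂ) * t) ^ 2 * σ ^ 2 / 2) =
      (1 + (t : ℂ) ^ 2 * ((1 + γ) * σ) ^ 2 / 2) := by ring
  simp only [Complex.real_smul]
  push_cast
  rw [e4]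
  generalize hA : 1 + (t : ℂ) ^ 2 * σ ^ 2 / 2 = A at e1
  generalize hB : 1 + (t : ℂ) ^ 2 * ((1 + γ) * σ) ^ 2 / 2 = B at e2
  have hAB : (1 + γ : ℂ) ^ 2 * (A - 1) = B - 1 := by rw [← hA, ← hB]; ring
  field_simp
  linear_combination -hAB

/-- Adding independent `dilationNoise` coordinatewise dilates the double exponential noise. -/
lemma map_add_pi_doubleExp {ι : Type*} [Fintype ι] {σ γ : ℝ} (hσ : 0 < σ) (hγ : 0 ≤ γ) :
    ((Measure.pi fun _ : ι => doubleExp σ).prod (Measure.pi fun _ : ι => dilationNoise σ γ)).map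
      (fun q => q.1 + q.2) = (Measure.pi fun _ : ι => doubleExp σ).map (fun v => (1 + γ) • v) := by
  have := isProbabilityMeasure_doubleExp hσ
  have := isProbabilityMeasure_dilationNoise hσ hγ
  have : IsProbabilityMeasure ((doubleExp σ).map ((1 + γ) * ·)) :=
    Measure.isProbabilityMeasure_map (by fun_prop)
  have hadd : Measurable fun q : ℝ × ℝ => q.1 + q.2 := by fun_prop
  have : IsProbabilityMeasure (((doubleExp σ).prod (dilationNoise σ γ)).map
      (fun q => q.1 + q.2)) := Measure.isProbabilityMeasure_map hadd.aemeasurable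
  rw [← (measurePreserving_arrowProdEquivProdArrow ℝ ℝ ι (fun _ => doubleExp σ)
    (fun _ => dilationNoise σ γ)).map_eq, Measure.map_map (by fun_prop)
    (MeasurableEquiv.measurable _)]
  have h1 := Measure.pi_map_pi (μ := fun _ : ι => (doubleExp σ).prod (dilationNoise σ γ))
    (f := fun _ q => q.1 + q.2) (fun _ => hadd.aemeasurable)
  have h2 := Measure.pi_map_pi (μ := fun _ : ι => doubleExp σ)
    (f := fun _ x => (1 + γ) * x) (fun _ => by fun_prop)
  have h3 := doubleExp_conv_dilationNoise hσ hγ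
  rw [Measure.conv] at h3
  rw [h3] at h1
  exact h1.trans h2.symm

/-! ### An elementary exponential inequality. -/

/-- Used with A = |α|², a = ⟨α,d⟩, b = |d|² and |α+d|² ≤ R. The bound is linear in a, so it averages
to 1 when d is centred. The second-order error 2k²a² of log(1 - 2ka) is at most 2k²Rb by
Cauchy–Schwarz, hence is paid for by kcb. -/
lemma exp_neg_quadratic_le {a b A R k c : ℝ} (hb : 0 ≤ b) (hab : a ^ 2 ≤ A * b) (hA : 0 ≤ A)
    (hAR : A ≤ R) (hR : A + 2 * a + b ≤ R) (hk : 0 ≤ k) (hkR : 2 * k * R ≤ c) (hc : c ≤ 1) :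
    Real.exp (-(k * (2 * a + c * b))) ≤ 1 - 2 * k * a := by
  rcases le_or_gt a 0 with ha | ha
  · have hv : 0 ≤ -(2 * k * a) := by nlinarith [mul_nonneg hk (neg_nonneg.mpr ha)]
    have hpos : 0 < 1 - 2 * k * a := by linarith
    rw [← Real.le_log_iff_exp_le hpos]
    have h1 := Real.le_log_one_add_of_nonneg hv
    have h2 : -(2 * k * a) - (2 * k * a) ^ 2 / 2 ≤ 2 * -(2 * k * a) / (-(2 * k * a) + 2) := by
      rw [show (2 * k * a) ^ 2 = (-(2 * k * a)) ^ 2 by ring]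
      generalize -(2 * k * a) = v at hv
      rw [le_div_iff₀ (by linarith)]
      have : 0 ≤ v ^ 3 := by positivity
      linarith
    have h3 : (2 * k * a) ^ 2 / 2 ≤ k * (c * b) := by
      calc (2 * k * a) ^ 2 / 2 = 2 * k * k * a ^ 2 := by ring
        _ ≤ 2 * k * k * (A * b) := by gcongr
        _ ≤ 2 * k * k * (R * b) := by gcongr
        _ = k * b * (2 * k * R) := by ring
        _ ≤ k * b * c := by gcongr
        _ = _ := by ring
    rw [show 1 + -(2 * k * a) = 1 - 2 * k * a by ring] at h1
    linarith
  · have hR0 : 0 < R := by linarith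
    have hkR1 : k * R ≤ 1 / 2 := by linarith
    have hka : 2 * k * a ≤ k * R := by nlinarith
    have hpos : 0 < 1 - 2 * k * a := by linarith
    set x := 1 - 2 * k * a with hx
    have hx1 : x ≤ 1 := by
      have : 0 ≤ 2 * k * a := by positivity
      linarith
    rw [← Real.le_log_iff_exp_le hpos]
    -- This is y ≤ sinh y at y = -log x. It costs an extra factor 1/x in the quadratic term,
    -- absorbed because A + 2a + b ≤ R and kR ≤ 1/2 leave room for A ≤ Rx.
    have hlog : -Real.log x ≤ (1 / x - x) / 2 := by
      have h := Real.self_le_sinh_iff.mpr (neg_nonneg.mpr (Real.log_nonpos hpos.le hx1))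
      rwa [Real.sinh_eq, neg_neg, Real.exp_neg, Real.exp_log hpos, ← one_div] at h
    have hsplit : (1 / x - x) / 2 = 2 * k * a + 2 * k * k * (a ^ 2 / x) := by
      have h : 2 * k * a = 1 - x := by rw [hx]; ring
      have h' : 2 * k * k * (a ^ 2 / x) = (1 - x) ^ 2 / (2 * x) := by
        rw [← h]
        field_simp
      rw [h', h]
      field_simp
      ring
    have hfrac : a ^ 2 / x ≤ R * b := by
      rw [div_le_iff₀ hpos]
      have h1 : A ≤ R * x := by
        have : R * x = R - 2 * a * (k * R) := by rw [hx]; ring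
        rw [this]
        nlinarith
      calc a ^ 2 ≤ A * b := hab
        _ ≤ R * x * b := by gcongr
        _ = _ := by ring
    have h3 : 2 * k * k * (a ^ 2 / x) ≤ k * (c * b) := by
      calc 2 * k * k * (a ^ 2 / x) ≤ 2 * k * k * (R * b) := by gcongr
        _ = k * b * (2 * k * R) := by ring
        _ ≤ k * b * c := by gcongr
        _ = _ := by ring
    linarith

/-! ### Bounds on log ∫ exp h. -/

section LogIntegralExp

variable {Λ : Type*} [MeasurableSpace Λ]

lemma integrable_exp_of_abs_le {π : Measure Λ} [IsFiniteMeasure π] {h : Λ → ℝ}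
    (hm : Measurable h) {C : ℝ} (hC : ∀ l, |h l| ≤ C) :
    Integrable (fun l => Real.exp (h l)) π :=
  (integrable_const (Real.exp C)).mono' (by fun_prop) (.of_forall fun l => by
    rw [Real.norm_eq_abs, Real.abs_exp]
    exact Real.exp_le_exp.mpr (abs_le.mp (hC l)).2)

lemma abs_log_integral_exp_le {π : Measure Λ} [IsProbabilityMeasure π] {h : Λ → ℝ}
    (hm : Measurable h) {C : ℝ} (hC : ∀ l, |h l| ≤ C) :
    |Real.log (∫ l, Real.exp (h l) ∂π)| ≤ C := by
  have hi := integrable_exp_of_abs_le (π := π) hm hC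
  have hpos : 0 < ∫ l, Real.exp (h l) ∂π := integral_exp_pos hi
  rw [abs_le]
  constructor
  · rw [Real.le_log_iff_exp_le hpos]
    calc Real.exp (-C) = ∫ _, Real.exp (-C) ∂π := by simp
      _ ≤ _ := integral_mono (integrable_const _) hi fun l =>
        Real.exp_le_exp.mpr (abs_le.mp (hC l)).1
  · rw [Real.log_le_iff_le_exp hpos]
    calc _ ≤ ∫ _, Real.exp C ∂π := integral_mono hi (integrable_const _) fun l =>
          Real.exp_le_exp.mpr (abs_le.mp (hC l)).2
      _ = _ := by simp

/-- The Donsker–Varadhan lower bound for bounded functions. -/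
lemma integral_sub_klDiv_le_log_integral_exp {p π : Measure Λ} [IsProbabilityMeasure p]
    [IsProbabilityMeasure π] (hp : p ≪ π) (hllr : Integrable (llr p π) p) {h : Λ → ℝ}
    (hm : Measurable h) {C : ℝ} (hC : ∀ l, |h l| ≤ C) :
    ∫ l, h l ∂p - (klDiv p π).toReal ≤ Real.log (∫ l, Real.exp (h l) ∂π) := by
  have hi := integrable_exp_of_abs_le (π := π) hm hC
  have hip : Integrable h p := (integrable_const C).mono' (by fun_prop) (.of_forall hC)
  have : IsProbabilityMeasure (π.tilted h) := isProbabilityMeasure_tilted hi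
  have hpt : p ≪ π.tilted h := hp.trans (absolutelyContinuous_tilted hi)
  have h1 := integral_llr_tilted_right hp hip hi hllr
  rw [← toReal_klDiv_of_measure_eq hpt (by simp), ← toReal_klDiv_of_measure_eq hp (by simp)] at h1
  have h2 : 0 ≤ (klDiv p (π.tilted h)).toReal := ENNReal.toReal_nonneg
  linarith

/-- Jensen for u ↦ u^s, obtained by integrating its tangent line at u = 1 (Bernoulli) with u = exp h
/ Z, a variable of mean 1. -/
lemma mul_log_integral_exp_le {π : Measure Λ} [IsProbabilityMeasure π] {h : Λ → ℝ}
    (hm : Measurable h) {C : ℝ} (hC : ∀ l, |h l| ≤ C) {s : ℝ} (hs : 1 ≤ s) :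
    s * Real.log (∫ l, Real.exp (h l) ∂π) ≤ Real.log (∫ l, Real.exp (s * h l) ∂π) := by
  have hi := integrable_exp_of_abs_le (π := π) hm hC
  have his := integrable_exp_of_abs_le (π := π) (h := fun l => s * h l) (C := s * C)
    (by fun_prop) (fun l => by
      rw [abs_mul, abs_of_nonneg (by linarith)]
      gcongr
      exact hC l)
  have hpos : 0 < ∫ l, Real.exp (h l) ∂π := integral_exp_pos hi
  have hposs : 0 < ∫ l, Real.exp (s * h l) ∂π := integral_exp_pos his
  set Z := ∫ l, Real.exp (h l) ∂π with hZ
  rw [Real.le_log_iff_exp_le hposs]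
  have key : ∀ l, Real.exp (s * Real.log Z) * (1 + s * (Real.exp (h l) / Z - 1)) ≤
      Real.exp (s * h l) := by
    intro l
    have h0 : 0 < Real.exp (h l) / Z := by positivity
    have h1 := one_add_mul_self_le_rpow_one_add (s := Real.exp (h l) / Z - 1)
      (by linarith) hs
    rw [add_sub_cancel, Real.rpow_def_of_pos h0, Real.log_div (by positivity) hpos.ne',
      Real.log_exp] at h1
    calc _ ≤ Real.exp (s * Real.log Z) * Real.exp ((h l - Real.log Z) * s) := by gcongr
      _ = _ := by
        rw [← Real.exp_add]
        congr 1
        ring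
  have hint' : Integrable (fun l => s * (Real.exp (h l) / Z - 1)) π :=
    ((hi.div_const Z).sub (integrable_const _)).const_mul s
  have hint : Integrable (fun l => 1 + s * (Real.exp (h l) / Z - 1)) π :=
    (integrable_const _).add hint'
  have h2 := integral_mono (hint.const_mul (Real.exp (s * Real.log Z))) his key
  rw [integral_const_mul, integral_add (integrable_const _) hint', integral_const_mul,
    integral_sub (hi.div_const Z) (integrable_const _), integral_div, ← hZ, div_self hpos.ne'] at h2
  simpa using h2

end LogIntegralExp

/-! ### Gibbs exponents and log-partition functions. -/

section LogPartition

variable {Λ ι : Type*} [Fintype ι]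

/-- The exponent of the Gibbs weights in the noise direction `η` with quadratic penalty `s`. -/
noncomputable def gibbsExponent (g : Λ → ι → ℝ) (β s : ℝ) (η : ι → ℝ) (l : Λ) : ℝ :=
  (2 * ∑ i, η i * g l i - s * ∑ i, g l i ^ 2) / β

variable {g : Λ → ι → ℝ} {β R s : ℝ}

lemma abs_gibbsExponent_le (hR : ∀ l, ∑ i, g l i ^ 2 ≤ R) (hβ : 0 < β) (hs : 0 ≤ s)
    (η : ι → ℝ) (l : Λ) : |gibbsExponent g β s η l| ≤ (2 * √R * ∑ i, |η i| + s * R) / β := by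
  rw [gibbsExponent, abs_div, abs_of_pos hβ]
  gcongr
  have h0 : 0 ≤ ∑ i, g l i ^ 2 := Finset.sum_nonneg fun i _ => sq_nonneg _
  have hgi : ∀ i, |g l i| ≤ √R := fun i => by
    refine Real.abs_le_sqrt (le_trans ?_ (hR l))
    exact Finset.single_le_sum (f := fun i => g l i ^ 2) (fun i _ => sq_nonneg _)
      (Finset.mem_univ i)
  have h1 : |∑ i, η i * g l i| ≤ √R * ∑ i, |η i| := by
    rw [Finset.mul_sum]
    refine (Finset.abs_sum_le_sum_abs _ _).trans (Finset.sum_le_sum fun i _ => ?_)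
    rw [abs_mul, mul_comm]
    gcongr
    exact hgi i
  refine (abs_sub _ _).trans ?_
  rw [abs_mul, abs_mul, abs_of_nonneg hs, abs_of_nonneg h0, abs_two]
  have := mul_le_mul_of_nonneg_left (hR l) hs
  linarith

variable [MeasurableSpace Λ]

/-- The log-partition function of the Gibbs weights. -/
noncomputable def logPartition (π : Measure Λ) (g : Λ → ι → ℝ) (β s : ℝ) (η : ι → ℝ) : ℝ :=
  Real.log (∫ l, Real.exp (gibbsExponent g β s η l) ∂π)

lemma measurable_uncurry_gibbsExponent (hg : ∀ i, Measurable fun l => g l i) :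
    Measurable fun q : (ι → ℝ) × Λ => gibbsExponent g β s q.1 q.2 := by
  unfold gibbsExponent
  fun_prop

lemma measurable_gibbsExponent (hg : ∀ i, Measurable fun l => g l i) (η : ι → ℝ) :
    Measurable (gibbsExponent g β s η) := by
  unfold gibbsExponent
  fun_prop

lemma measurable_logPartition {π : Measure Λ} [SFinite π] (hg : ∀ i, Measurable fun l => g l i) :
    Measurable (logPartition π g β s) := by
  unfold logPartition
  refine Real.measurable_log.comp ?_
  exact (StronglyMeasurable.integral_prod_right
    (f := fun η l => Real.exp (gibbsExponent g β s η l))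
    (measurable_uncurry_gibbsExponent hg).exp.stronglyMeasurable).measurable

lemma abs_logPartition_le {π : Measure Λ} [IsProbabilityMeasure π]
    (hg : ∀ i, Measurable fun l => g l i) (hR : ∀ l, ∑ i, g l i ^ 2 ≤ R) (hβ : 0 < β)
    (hs : 0 ≤ s) (η : ι → ℝ) :
    |logPartition π g β s η| ≤ (2 * √R * ∑ i, |η i| + s * R) / β :=
  abs_log_integral_exp_le (measurable_gibbsExponent hg η) (abs_gibbsExponent_le hR hβ hs η)

lemma integrable_logPartition_comp {π : Measure Λ} [IsProbabilityMeasure π]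
    (hg : ∀ i, Measurable fun l => g l i) (hR : ∀ l, ∑ i, g l i ^ 2 ≤ R) (hβ : 0 < β)
    (hs : 0 ≤ s) {T : Type*} [MeasurableSpace T] {Q : Measure T} [IsFiniteMeasure Q]
    {η : T → ι → ℝ} (hη : ∀ i, Integrable (fun t => η t i) Q) :
    Integrable (fun t => logPartition π g β s (η t)) Q := by
  have hb : Integrable (fun t => (2 * √R * ∑ i, |η t i| + s * R) / β) Q :=
    (((integrable_finsetSum _ fun i _ => (hη i).abs).const_mul _).add
      (integrable_const _)).div_const β
  refine hb.mono' ?_ (.of_forall fun t => abs_logPartition_le hg hR hβ hs _)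
  exact (measurable_logPartition hg).comp_aemeasurable
    (aemeasurable_pi_lambda _ fun i => (hη i).aemeasurable) |>.aestronglyMeasurable

end LogPartition

/-! ### Averaging over the dilation noise. -/

section Smoothing

variable {Λ ι : Type*} [MeasurableSpace Λ] [Fintype ι] {g : Λ → ι → ℝ} {β R D σ γ : ℝ}

lemma integrable_of_sum_sq_le {ρ : Measure Λ} [IsFiniteMeasure ρ]
    (hg : ∀ i, Measurable fun l => g l i) (hR : ∀ l, ∑ i, g l i ^ 2 ≤ R) (i : ι) :
    Integrable (fun l => g l i) ρ := by
  refine (integrable_const (√R)).mono' (hg i).aestronglyMeasurable (.of_forall fun l => ?_)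
  refine Real.abs_le_sqrt (le_trans ?_ (hR l))
  exact Finset.single_le_sum (f := fun i => g l i ^ 2) (fun i _ => sq_nonneg _)
    (Finset.mem_univ i)

/-- Integrate the tangent-line bound 2αg - α² ≤ g² at the mean α. -/
lemma sum_sq_integral_le {ρ : Measure Λ} [IsProbabilityMeasure ρ]
    (hg : ∀ i, Measurable fun l => g l i) (hR : ∀ l, ∑ i, g l i ^ 2 ≤ R) :
    ∑ i, (∫ l, g l i ∂ρ) ^ 2 ≤ R := by
  have hgi := integrable_of_sum_sq_le (ρ := ρ) hg hR
  set α : ι → ℝ := fun i => ∫ l, g l i ∂ρ with hα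
  have h1 : ∀ l, ∑ i, (2 * α i * g l i - α i ^ 2) ≤ R := fun l => by
    refine le_trans (Finset.sum_le_sum fun i _ => ?_) (hR l)
    nlinarith [sq_nonneg (g l i - α i)]
  have hint : ∀ i, Integrable (fun l => 2 * α i * g l i - α i ^ 2) ρ := fun i =>
    ((hgi i).const_mul _).sub (integrable_const _)
  have h2 := integral_mono (μ := ρ) (integrable_finsetSum _ fun i _ => hint i)
    (integrable_const R) h1
  rw [integral_finsetSum _ fun i _ => hint i] at h2
  simp only [integral_const, probReal_univ, one_smul] at h2
  refine le_trans (Finset.sum_le_sum fun i _ => ?_) h2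
  rw [integral_sub ((hgi i).const_mul _) (integrable_const _), integral_const_mul]
  simp only [integral_const, probReal_univ, one_smul]
  change α i ^ 2 ≤ 2 * α i * α i - α i ^ 2
  linarith

/-- Averaging the Gibbs log-partition function over the dilation noise produces the squared norm
of the mean. -/
lemma integral_logPartition_dilationNoise_le {ρ : Measure Λ} [IsProbabilityMeasure ρ]
    (hg : ∀ i, Measurable fun l => g l i) (hR : ∀ l, ∑ i, g l i ^ 2 ≤ R)
    (hD : ∀ i l, |g l i - ∫ l', g l' i ∂ρ| ≤ D) (hσ : 0 < σ) (hγ : 0 ≤ γ) (hβ : 0 < β)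
    (hβD : 2 * D * ((1 + γ) * σ) ≤ β) (hβR : (8 + 4 * γ) * σ ^ 2 + 2 * γ * R ≤ β) :
    ∫ ζ, logPartition ρ g β γ ζ ∂(Measure.pi fun _ : ι => dilationNoise σ γ) ≤
      -(γ / β * ∑ i, (∫ l, g l i ∂ρ) ^ 2) := by
  have := isProbabilityMeasure_dilationNoise hσ hγ
  obtain ⟨l0⟩ : Nonempty Λ := nonempty_of_isProbabilityMeasure ρ
  set N := Measure.pi fun _ : ι => dilationNoise σ γ with hN
  have hgi := integrable_of_sum_sq_le (ρ := ρ) hg hR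
  set α : ι → ℝ := fun i => ∫ l, g l i ∂ρ with hα
  have hαR : ∑ i, α i ^ 2 ≤ R := sum_sq_integral_le hg hR
  have hR0 : 0 ≤ R := (Finset.sum_nonneg fun i _ => sq_nonneg (α i)).trans hαR
  set d : Λ → ι → ℝ := fun l i => g l i - α i with hd
  have hdm : ∀ i, Measurable fun l => d l i := fun i => (hg i).sub_const _
  have hdD : ∀ i l, |d l i| ≤ D := hD
  have hdi : ∀ i, Integrable (fun l => d l i) ρ := fun i => (hgi i).sub (integrable_const _)
  have hd0 : ∀ i, ∫ l, d l i ∂ρ = 0 := fun i => by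
    simp only [hd]
    rw [integral_sub (hgi i) (integrable_const _)]
    simp [hα]
  set k : ℝ := γ / β with hk
  have hk0 : 0 ≤ k := by positivity
  set a : Λ → ℝ := fun l => ∑ i, α i * d l i with ha
  set b : Λ → ℝ := fun l => ∑ i, d l i ^ 2 with hb
  have ham : Measurable a := by fun_prop
  have hbm : Measurable b := by fun_prop
  have hai : Integrable a ρ := integrable_finsetSum _ fun i _ => (hdi i).const_mul _
  have ha0 : ∫ l, a l ∂ρ = 0 := by
    simp only [ha]
    rw [integral_finsetSum _ fun i _ => (hdi i).const_mul _]
    simp [integral_const_mul, hd0]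
  have hb0 : ∀ l, 0 ≤ b l := fun l => Finset.sum_nonneg fun i _ => sq_nonneg _
  have habR : ∀ l, ∑ i, g l i ^ 2 = ∑ i, α i ^ 2 + 2 * a l + b l := fun l => by
    simp only [ha, hb, Finset.mul_sum, ← Finset.sum_add_distrib]
    refine Finset.sum_congr rfl fun i _ => ?_
    simp only [hd]
    ring
  -- the recentred partition function
  set w : (ι → ℝ) → Λ → ℝ := fun ζ l =>
    Real.exp (-(k * (2 * a l + b l))) * ∏ i, Real.exp (2 / β * d l i * ζ i) with hw
  have hwm : Measurable (Function.uncurry w) := by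
    simp only [hw, Function.uncurry_def]
    fun_prop
  -- The guard matters when `ι` is empty: `hD` is then vacuous and D may be negative.
  have hτ : 0 ≤ D → |2 / β * D| * ((1 + γ) * σ) ≤ 1 := fun hD0 => by
    rw [abs_of_nonneg (by positivity)]
    calc 2 / β * D * ((1 + γ) * σ) = 2 * D * ((1 + γ) * σ) / β := by ring
      _ ≤ 1 := by rwa [div_le_one hβ]
  have hexp_eq : ∀ ζ l, Real.exp (gibbsExponent g β γ ζ l) =
      Real.exp (2 / β * ∑ i, ζ i * α i - k * ∑ i, α i ^ 2) * w ζ l := fun ζ l => by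
    simp only [hw, gibbsExponent]
    rw [habR, ← Real.exp_sum, ← Real.exp_add, ← Real.exp_add]
    congr 1
    have h1 : ∑ i, ζ i * g l i = ∑ i, ζ i * α i + ∑ i, d l i * ζ i := by
      rw [← Finset.sum_add_distrib]
      refine Finset.sum_congr rfl fun i _ => ?_
      simp only [hd]
      ring
    have h2 : ∑ i, 2 / β * d l i * ζ i = 2 / β * ∑ i, d l i * ζ i := by
      rw [Finset.mul_sum]
      exact Finset.sum_congr rfl fun i _ => by ring
    rw [h1, h2, hk]
    field_simp
    ring
  have hwprod : Integrable (Function.uncurry w) (N.prod ρ) := by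
    have hprod : Integrable (fun ζ : ι → ℝ => Real.exp (k * R) *
        ∏ i, Real.exp (2 / β * D * |ζ i|)) N := by
      refine Integrable.const_mul ?_ _
      refine Integrable.fintype_prod (μ := fun _ : ι => dilationNoise σ γ)
        (f := fun _ x => Real.exp (2 / β * D * |x|)) fun i => ?_
      refine integrable_exp_mul_abs_dilationNoise hσ hγ (hτ ?_)
      exact (abs_nonneg _).trans (hdD i l0)
    refine (hprod.comp_fst ρ).mono' hwm.aestronglyMeasurable (.of_forall fun q => ?_)
    have hnn : 0 ≤ w q.1 q.2 := by
      simp only [hw]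
      positivity
    simp only [Function.uncurry_def]
    rw [Real.norm_eq_abs, abs_of_nonneg hnn]
    simp only [hw]
    refine mul_le_mul (Real.exp_le_exp.mpr ?_) (Finset.prod_le_prod
      (fun i _ => (Real.exp_pos _).le) fun i _ => Real.exp_le_exp.mpr ?_)
      (by positivity) (Real.exp_pos _).le
    · have h1 : 0 ≤ ∑ i, g q.2 i ^ 2 := Finset.sum_nonneg fun i _ => sq_nonneg _
      rw [habR] at h1
      have h2 : -(2 * a q.2 + b q.2) ≤ R := by linarith
      calc -(k * (2 * a q.2 + b q.2)) = k * (-(2 * a q.2 + b q.2)) := by ring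
        _ ≤ k * R := by gcongr
    · calc 2 / β * d q.2 i * q.1 i ≤ |2 / β * d q.2 i * q.1 i| := le_abs_self _
        _ = 2 / β * |d q.2 i| * |q.1 i| := by
          rw [abs_mul, abs_mul, abs_of_nonneg (by positivity : 0 ≤ 2 / β)]
        _ ≤ _ := by
          gcongr
          exact hdD i _
  -- integrating out the noise
  have hmgf : ∀ l, ∫ ζ, w ζ l ∂N ≤ 1 - 2 * k * a l := fun l => by
    simp only [hw]
    rw [integral_const_mul, integral_fintype_prod_eq_prod (𝕜 := ℝ)
      (fun i x => Real.exp (2 / β * d l i * x))]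
    have hle : ∏ i, ∫ x, Real.exp (2 / β * d l i * x) ∂(dilationNoise σ γ) ≤
        ∏ i, Real.exp ((2 * γ + γ ^ 2) * σ ^ 2 * (2 / β * d l i) ^ 2) := by
      refine Finset.prod_le_prod (fun i _ => integral_nonneg fun x => (Real.exp_pos _).le)
        fun i _ => integral_exp_mul_dilationNoise_le hσ hγ ?_
      have hD0 : 0 ≤ D := (abs_nonneg _).trans (hdD i l0)
      refine le_trans ?_ (hτ hD0)
      rw [abs_mul, abs_mul, abs_of_nonneg hD0]
      gcongr
      exact hdD i l
    refine (mul_le_mul_of_nonneg_left hle (Real.exp_pos _).le).trans ?_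
    rw [← Real.exp_sum, ← Real.exp_add]
    have hcs : a l ^ 2 ≤ (∑ i, α i ^ 2) * b l := Finset.sum_mul_sq_le_sq_mul_sq _ _ _
    -- The noise transform adds (2γ+γ²)σ²(2/β)²b = k · (8+4γ)σ²/β · b to the exponent; c is the
    -- share of the penalty kb that survives.
    have hmain := exp_neg_quadratic_le (c := 1 - (8 + 4 * γ) * σ ^ 2 / β) (k := k) (hb0 l) hcs
      (Finset.sum_nonneg fun i _ => sq_nonneg _) hαR (by rw [← habR]; exact hR l) hk0
      (by
        rw [hk, le_sub_iff_add_le]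
        calc 2 * (γ / β) * R + (8 + 4 * γ) * σ ^ 2 / β
            = ((8 + 4 * γ) * σ ^ 2 + 2 * γ * R) / β := by ring
          _ ≤ 1 := by rwa [div_le_one hβ])
      (by
        have : 0 ≤ (8 + 4 * γ) * σ ^ 2 / β := by positivity
        linarith)
    refine le_trans (le_of_eq ?_) hmain
    congr 1
    have : ∑ i, (2 * γ + γ ^ 2) * σ ^ 2 * (2 / β * d l i) ^ 2 =
        (2 * γ + γ ^ 2) * σ ^ 2 * (2 / β) ^ 2 * b l := by
      rw [hb, Finset.mul_sum]
      exact Finset.sum_congr rfl fun i _ => by ring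
    rw [this, hk]
    field_simp
    ring
  have hW : ∫ ζ, ∫ l, w ζ l ∂ρ ∂N ≤ 1 := by
    rw [integral_integral_swap hwprod]
    calc _ ≤ ∫ l, (1 - 2 * k * a l) ∂ρ := by
          refine integral_mono hwprod.integral_prod_right
            ((integrable_const _).sub (hai.const_mul _)) hmgf
      _ = 1 := by
          rw [integral_sub (integrable_const _) (hai.const_mul _), integral_const_mul, ha0]
          simp
  have hζi : ∀ i, Integrable (fun ζ : ι → ℝ => ζ i) N := fun i =>
    integrable_comp_eval (μ := fun _ : ι => dilationNoise σ γ) (f := fun x : ℝ => x)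
      (integrable_dilationNoise (integrable_id_doubleExp (by positivity)))
  have hζ0 : ∀ i, ∫ ζ, ζ i ∂N = 0 := fun i => by
    rw [hN, integral_comp_eval (μ := fun _ : ι => dilationNoise σ γ) (f := fun x : ℝ => x)
      (by fun_prop), integral_id_dilationNoise hσ hγ]
  -- With log u ≤ u - 1 the logarithm of ∫ w becomes linear, so `hW` applies after integration; the
  -- remaining term in ζ is centred.
  have hpt : ∀ ζ, logPartition ρ g β γ ζ ≤
      2 / β * ∑ i, ζ i * α i + (∫ l, w ζ l ∂ρ - 1 - k * ∑ i, α i ^ 2) := fun ζ => by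
    have hpos : 0 < ∫ l, Real.exp (gibbsExponent g β γ ζ l) ∂ρ :=
      integral_exp_pos (integrable_exp_of_abs_le (measurable_gibbsExponent hg ζ)
        (abs_gibbsExponent_le hR hβ hγ ζ))
    have hfac : ∫ l, Real.exp (gibbsExponent g β γ ζ l) ∂ρ =
        Real.exp (2 / β * ∑ i, ζ i * α i - k * ∑ i, α i ^ 2) * ∫ l, w ζ l ∂ρ := by
      rw [← integral_const_mul]
      simp only [hexp_eq]
    have hwpos : 0 < ∫ l, w ζ l ∂ρ := by
      rw [hfac] at hpos
      exact (mul_pos_iff_of_pos_left (Real.exp_pos _)).mp hpos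
    rw [logPartition, hfac, Real.log_mul (Real.exp_pos _).ne' hwpos.ne', Real.log_exp]
    have := Real.log_le_sub_one_of_pos hwpos
    linarith
  have hi1 : Integrable (fun ζ : ι → ℝ => 2 / β * ∑ i, ζ i * α i) N :=
    (integrable_finsetSum _ fun i _ => (hζi i).mul_const _).const_mul _
  have hi2 : Integrable (fun ζ : ι → ℝ => ∫ l, w ζ l ∂ρ) N := hwprod.integral_prod_left
  have hi3 : Integrable (fun ζ : ι → ℝ => ∫ l, w ζ l ∂ρ - 1) N := hi2.sub (integrable_const _)
  have hi4 : Integrable (fun ζ : ι → ℝ => ∫ l, w ζ l ∂ρ - 1 - k * ∑ i, α i ^ 2) N :=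
    hi3.sub (integrable_const _)
  refine (integral_mono (integrable_logPartition_comp hg hR hβ hγ hζi) (hi1.add hi4) hpt).trans ?_
  rw [integral_add' hi1 hi4, integral_sub hi3 (integrable_const _),
    integral_sub hi2 (integrable_const _), integral_const_mul,
    integral_finsetSum _ fun i _ => (hζi i).mul_const _]
  simp only [integral_mul_const, hζ0, integral_const, probReal_univ, one_smul, zero_mul,
    Finset.sum_const_zero, mul_zero]
  linarith

end Smoothing

/-! ### The PAC-Bayesian risk bound. -/

section Oracle

variable {Λ ι : Type*} [Fintype ι] {g : Λ → ι → ℝ} {β R D σ γ : ℝ}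

lemma gibbsExponent_add (s r : ℝ) (η ζ : ι → ℝ) (l : Λ) :
    gibbsExponent g β s η l + gibbsExponent g β r ζ l = gibbsExponent g β (s + r) (η + ζ) l := by
  simp only [gibbsExponent, Pi.add_apply, add_mul, Finset.sum_add_distrib]
  ring

lemma gibbsExponent_smul (s : ℝ) (η : ι → ℝ) (l : Λ) :
    gibbsExponent g β s (s • η) l = s * gibbsExponent g β 1 η l := by
  simp only [gibbsExponent, Pi.smul_apply, smul_eq_mul, mul_assoc, ← Finset.mul_sum]
  ring

variable [MeasurableSpace Λ]

lemma isProbabilityMeasure_tilted_gibbsExponent {π : Measure Λ} [IsProbabilityMeasure π]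
    (hg : ∀ i, Measurable fun l => g l i) (hR : ∀ l, ∑ i, g l i ^ 2 ≤ R) (hβ : 0 < β)
    (ξ : ι → ℝ) : IsProbabilityMeasure (π.tilted (gibbsExponent g β 1 ξ)) :=
  isProbabilityMeasure_tilted (integrable_exp_of_abs_le (measurable_gibbsExponent hg ξ)
    (abs_gibbsExponent_le hR hβ zero_le_one ξ))

/-- Exponents add in both the noise and the penalty, so this identifies Ψ(ξ+ζ) - Φ(ξ) with a
log-partition function under the Gibbs measure at ξ. -/
lemma logPartition_tilted {π : Measure Λ} [IsProbabilityMeasure π]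
    (hg : ∀ i, Measurable fun l => g l i) (hR : ∀ l, ∑ i, g l i ^ 2 ≤ R) (hβ : 0 < β)
    (hγ : 0 ≤ γ) (ξ ζ : ι → ℝ) :
    logPartition (π.tilted (gibbsExponent g β 1 ξ)) g β γ ζ =
      logPartition π g β (1 + γ) (ξ + ζ) - logPartition π g β 1 ξ := by
  have hpos : ∀ {s : ℝ} (η : ι → ℝ), 0 ≤ s →
      0 < ∫ l, Real.exp (gibbsExponent g β s η l) ∂π := fun η hs =>
    integral_exp_pos (integrable_exp_of_abs_le (measurable_gibbsExponent hg η)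
      (abs_gibbsExponent_le hR hβ hs η))
  rw [logPartition, integral_exp_tilted, logPartition, logPartition,
    ← Real.log_div (hpos _ (by linarith)).ne' (hpos _ zero_le_one).ne']
  simp only [Pi.add_apply, gibbsExponent_add]

/-- Makes the deviation bound D uniform over all Gibbs measures, whatever ξ. -/
lemma abs_sub_integral_le {ρ : Measure Λ} [IsProbabilityMeasure ρ] {h : Λ → ℝ}
    (hi : Integrable h ρ) (hD : ∀ l l', |h l - h l'| ≤ D) (l : Λ) :
    |h l - ∫ l', h l' ∂ρ| ≤ D := by
  have h1 : h l - ∫ l', h l' ∂ρ = ∫ l', (h l - h l') ∂ρ := by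
    rw [integral_sub (integrable_const _) hi]
    simp
  rw [h1]
  have := norm_integral_le_of_norm_le_const (μ := ρ) (f := fun l' => h l - h l') (C := D)
    (.of_forall fun l' => hD l l')
  simpa using this

lemma measurable_integral_tilted_gibbsExponent {π : Measure Λ} [IsProbabilityMeasure π]
    (hg : ∀ i, Measurable fun l => g l i) (i : ι) :
    Measurable fun ξ : ι → ℝ => ∫ l, g l i ∂(π.tilted (gibbsExponent g β 1 ξ)) := by
  simp only [integral_tilted, smul_eq_mul, div_mul_eq_mul_div, integral_div]
  have hG := measurable_uncurry_gibbsExponent (β := β) (s := 1) hg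
  have h1 := (StronglyMeasurable.integral_prod_right (ν := π)
    (f := fun ξ l => Real.exp (gibbsExponent g β 1 ξ l) * g l i)
    (hG.exp.mul ((hg i).comp measurable_snd)).stronglyMeasurable).measurable
  have h2 := (StronglyMeasurable.integral_prod_right (ν := π)
    (f := fun ξ l => Real.exp (gibbsExponent g β 1 ξ l)) hG.exp.stronglyMeasurable).measurable
  exact h1.div h2

lemma integrable_sum_sq_gibbsMean {π : Measure Λ} [IsProbabilityMeasure π]
    (hg : ∀ i, Measurable fun l => g l i) (hR : ∀ l, ∑ i, g l i ^ 2 ≤ R) (hβ : 0 < β)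
    {M : Measure (ι → ℝ)} [IsFiniteMeasure M] :
    Integrable (fun ξ => ∑ i, (∫ l, g l i ∂(π.tilted (gibbsExponent g β 1 ξ))) ^ 2) M := by
  refine (integrable_const R).mono' ?_ (.of_forall fun ξ => ?_)
  · exact (Finset.measurable_sum _ fun i _ =>
      (measurable_integral_tilted_gibbsExponent hg i).pow_const 2).aestronglyMeasurable
  · have := isProbabilityMeasure_tilted_gibbsExponent (π := π) hg hR hβ ξ
    rw [Real.norm_eq_abs, abs_of_nonneg (Finset.sum_nonneg fun i _ => sq_nonneg _)]
    exact sum_sq_integral_le hg hR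

/-- The PAC-Bayesian risk bound for Gibbs means under double exponential noise. -/
lemma integral_sum_sq_gibbsMean_le {π : Measure Λ} [IsProbabilityMeasure π]
    (hg : ∀ i, Measurable fun l => g l i) (hR : ∀ l, ∑ i, g l i ^ 2 ≤ R)
    (hD : ∀ i l l', |g l i - g l' i| ≤ D) (hσ : 0 < σ) (hγ : 0 < γ) (hβ : 0 < β)
    (hβD : 2 * D * ((1 + γ) * σ) ≤ β) (hβR : (8 + 4 * γ) * σ ^ 2 + 2 * γ * R ≤ β)
    {p : Measure Λ} [IsProbabilityMeasure p] (hp : p ≪ π) (hllr : Integrable (llr p π) p) :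
    ∫ ξ, ∑ i, (∫ l, g l i ∂(π.tilted (gibbsExponent g β 1 ξ))) ^ 2
        ∂(Measure.pi fun _ : ι => doubleExp σ) ≤
      ∫ l, ∑ i, g l i ^ 2 ∂p + β / (1 + γ) * (klDiv p π).toReal := by
  have := isProbabilityMeasure_doubleExp hσ
  have := isProbabilityMeasure_dilationNoise hσ hγ.le
  set M := Measure.pi fun _ : ι => doubleExp σ with hM
  set N := Measure.pi fun _ : ι => dilationNoise σ γ with hN
  have h1γ : 0 < 1 + γ := by linarith
  have hξi : ∀ i, Integrable (fun ξ : ι → ℝ => ξ i) M := fun i =>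
    integrable_comp_eval (μ := fun _ : ι => doubleExp σ) (f := fun x : ℝ => x)
      (integrable_id_doubleExp hσ)
  have hξ0 : ∀ i, ∫ ξ, ξ i ∂M = 0 := fun i => by
    rw [hM, integral_comp_eval (μ := fun _ : ι => doubleExp σ) (f := fun x : ℝ => x)
      (by fun_prop), integral_id_doubleExp]
  have hζi : ∀ i, Integrable (fun ζ : ι → ℝ => ζ i) N := fun i =>
    integrable_comp_eval (μ := fun _ : ι => dilationNoise σ γ) (f := fun x : ℝ => x)
      (integrable_dilationNoise (integrable_id_doubleExp (by positivity)))
  set A : (ι → ℝ) → ℝ := fun ξ => ∑ i, (∫ l, g l i ∂(π.tilted (gibbsExponent g β 1 ξ))) ^ 2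
    with hA
  have hAi : Integrable A M := integrable_sum_sq_gibbsMean hg hR hβ
  set Φ := logPartition π g β 1 with hΦ
  set Ψ := logPartition π g β (1 + γ) with hΨ
  have hΦi : Integrable Φ M := integrable_logPartition_comp hg hR hβ zero_le_one hξi
  have hΨi : Integrable (fun ξ => Ψ ((1 + γ) • ξ)) M :=
    integrable_logPartition_comp hg hR hβ h1γ.le fun i => (hξi i).const_mul (1 + γ)
  have hΨadd : Integrable (fun q : (ι → ℝ) × (ι → ℝ) => Ψ (q.1 + q.2)) (M.prod N) :=
    integrable_logPartition_comp hg hR hβ h1γ.le fun i =>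
      ((hξi i).comp_fst N).add ((hζi i).comp_snd M)
  have hΨm : Measurable Ψ := measurable_logPartition hg
  have hlaw : ∫ ξ, ∫ ζ, Ψ (ξ + ζ) ∂N ∂M = ∫ ξ, Ψ ((1 + γ) • ξ) ∂M := by
    rw [← integral_prod (fun q : (ι → ℝ) × (ι → ℝ) => Ψ (q.1 + q.2)) hΨadd,
      ← integral_map (φ := fun q : (ι → ℝ) × (ι → ℝ) => q.1 + q.2) (by fun_prop)
        hΨm.aestronglyMeasurable, map_add_pi_doubleExp hσ hγ.le,
      integral_map (by fun_prop) hΨm.aestronglyMeasurable]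
  have hstep : ∀ ξ, ∫ ζ, Ψ (ξ + ζ) ∂N ≤ Φ ξ - γ / β * A ξ := fun ξ => by
    have := isProbabilityMeasure_tilted_gibbsExponent (π := π) hg hR hβ ξ
    have h := integral_logPartition_dilationNoise_le
      (ρ := π.tilted (gibbsExponent g β 1 ξ)) hg hR
      (fun i => abs_sub_integral_le (integrable_of_sum_sq_le hg hR i) (hD i)) hσ hγ.le hβ hβD hβR
    simp only [logPartition_tilted hg hR hβ hγ.le] at h
    have hi : Integrable (fun ζ => Ψ (ξ + ζ)) N := integrable_logPartition_comp hg hR hβ h1γ.le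
      fun i => (integrable_const (ξ i)).add (hζi i)
    rw [integral_sub hi (integrable_const _)] at h
    simp only [integral_const, probReal_univ, one_smul] at h
    linarith
  have hsmooth : ∫ ξ, Ψ ((1 + γ) • ξ) ∂M ≤ ∫ ξ, Φ ξ ∂M - γ / β * ∫ ξ, A ξ ∂M := by
    rw [← hlaw, ← integral_const_mul, ← integral_sub hΦi (hAi.const_mul _)]
    exact integral_mono hΨadd.integral_prod_left (hΦi.sub (hAi.const_mul _)) hstep
  -- Penalty and noise are both scaled by 1 + γ, so the whole exponent is multiplied by 1 + γ.
  have hjensen : (1 + γ) * ∫ ξ, Φ ξ ∂M ≤ ∫ ξ, Ψ ((1 + γ) • ξ) ∂M := by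
    rw [← integral_const_mul]
    refine integral_mono (hΦi.const_mul _) hΨi fun ξ => ?_
    simp only [hΦ, hΨ, logPartition, gibbsExponent_smul]
    exact mul_log_integral_exp_le (measurable_gibbsExponent hg ξ)
      (abs_gibbsExponent_le hR hβ zero_le_one ξ) (by linarith)
  have hgp : ∀ i, Integrable (fun l => g l i) p := integrable_of_sum_sq_le hg hR
  have hgp2 : Integrable (fun l => ∑ i, g l i ^ 2) p :=
    (integrable_const R).mono' (by fun_prop) (.of_forall fun l => by
      rw [Real.norm_eq_abs, abs_of_nonneg (Finset.sum_nonneg fun i _ => sq_nonneg _)]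
      exact hR l)
  have hdv : -((1 + γ) / β * ∫ l, ∑ i, g l i ^ 2 ∂p + (klDiv p π).toReal) ≤
      ∫ ξ, Ψ ((1 + γ) • ξ) ∂M := by
    have hpt : ∀ ξ, (1 + γ) * (2 / β) * ∑ i, ξ i * ∫ l, g l i ∂p -
        ((1 + γ) / β * ∫ l, ∑ i, g l i ^ 2 ∂p + (klDiv p π).toReal) ≤ Ψ ((1 + γ) • ξ) :=
      fun ξ => by
        have h := integral_sub_klDiv_le_log_integral_exp hp hllr
          (measurable_gibbsExponent hg ((1 + γ) • ξ)) (abs_gibbsExponent_le hR hβ h1γ.le _)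
        have hint : ∫ l, gibbsExponent g β (1 + γ) ((1 + γ) • ξ) l ∂p =
            (1 + γ) * (2 / β) * ∑ i, ξ i * ∫ l, g l i ∂p -
              (1 + γ) / β * ∫ l, ∑ i, g l i ^ 2 ∂p := by
          simp only [gibbsExponent_smul]
          rw [integral_const_mul]
          simp only [gibbsExponent, one_mul]
          rw [integral_div, integral_sub ((integrable_finsetSum _ fun i _ =>
            (hgp i).const_mul _).const_mul _) hgp2, integral_const_mul,
            integral_finsetSum _ fun i _ => (hgp i).const_mul _]
          simp only [integral_const_mul]
          ring
        rw [hint] at h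
        change _ ≤ Real.log _
        linarith
    have hi : Integrable (fun ξ : ι → ℝ => (1 + γ) * (2 / β) * ∑ i, ξ i * ∫ l, g l i ∂p) M :=
      (integrable_finsetSum _ fun i _ => (hξi i).mul_const _).const_mul _
    have h := integral_mono (hi.sub (integrable_const _)) hΨi hpt
    rw [integral_sub' hi (integrable_const _), integral_const_mul,
      integral_finsetSum _ fun i _ => (hξi i).mul_const _] at h
    simpa [integral_mul_const, hξ0] using h
  set S := ∫ l, ∑ i, g l i ^ 2 ∂p
  set K := (klDiv p π).toReal
  set EA := ∫ ξ, A ξ ∂M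
  set EΦ := ∫ ξ, Φ ξ ∂M
  set EΨ := ∫ ξ, Ψ ((1 + γ) • ξ) ∂M
  have h1 : γ / β * EA ≤ EΦ - EΨ := by linarith
  have h2 : (1 + γ) * (γ / β * EA) ≤ γ * ((1 + γ) / β * S + K) := by
    -- `hjensen` replaces (1+γ)EΦ by EΨ, leaving -γEΨ for `hdv`.
    calc (1 + γ) * (γ / β * EA) ≤ (1 + γ) * (EΦ - EΨ) := by gcongr
      _ ≤ γ * -EΨ := by linarith
      _ ≤ _ := by gcongr; linarith
  have h3 : γ * (1 + γ) / β * EA ≤ γ * (1 + γ) / β * (S + β / (1 + γ) * K) := by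
    calc γ * (1 + γ) / β * EA = (1 + γ) * (γ / β * EA) := by ring
      _ ≤ γ * ((1 + γ) / β * S + K) := h2
      _ = _ := by field_simp
  exact le_of_mul_le_mul_left h3 (by positivity)

end Oracle

/-! ### From the aggregate to Gibbs means. -/

section Aggregate

variable {Λ X : Type*} [MeasurableSpace Λ] {n : ℕ} {x : Fin n → X} {f : X → ℝ} {F : Λ → X → ℝ}
  {π : Measure Λ} {β : ℝ}

lemma natCast_mul_empSq (hn : 1 ≤ n) (v : Fin n → ℝ) : (n : ℝ) * empSq v = ∑ i, v i ^ 2 := by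
  have : (n : ℝ) ≠ 0 := by positivity
  rw [empSq]
  field_simp

/-- Expanding |y - f_l|² around f leaves the factor exp(-|y - f|²/β), which cancels in the quotient.
-/
lemma weight_eq (hn : 1 ≤ n) (y : Fin n → ℝ) (l : Λ) :
    weight x F π β y l =
      Real.exp (gibbsExponent (fun l i => F l (x i) - f (x i)) β 1 (fun i => y i - f (x i)) l) /
        ∫ w, Real.exp (gibbsExponent (fun l i => F l (x i) - f (x i)) β 1
          (fun i => y i - f (x i)) w) ∂π := by
  have key : ∀ w, Real.exp (-((n : ℝ) * empSq (fun i => y i - F w (x i))) / β) =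
      Real.exp (-(∑ i, (y i - f (x i)) ^ 2) / β) *
        Real.exp (gibbsExponent (fun l i => F l (x i) - f (x i)) β 1
          (fun i => y i - f (x i)) w) := fun w => by
    rw [← Real.exp_add, gibbsExponent, natCast_mul_empSq hn, ← add_div]
    congr 2
    simp only [Finset.mul_sum, one_mul, ← Finset.sum_neg_distrib, ← Finset.sum_add_distrib,
      ← Finset.sum_sub_distrib]
    exact Finset.sum_congr rfl fun i _ => by ring
  rw [weight]
  simp only [key]
  rw [integral_const_mul, mul_div_mul_left _ _ (Real.exp_pos _).ne']

lemma aggregate_sub_eq [IsProbabilityMeasure π] (hn : 1 ≤ n) (hF : ∀ z, Measurable fun l => F l z)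
    {R : ℝ} (hR : ∀ l, ∑ i, (F l (x i) - f (x i)) ^ 2 ≤ R) (hβ : 0 < β) (y : Fin n → ℝ)
    (i : Fin n) :
    aggregate x F π β y (x i) - f (x i) =
      ∫ l, (F l (x i) - f (x i)) ∂(π.tilted (gibbsExponent (fun l i => F l (x i) - f (x i)) β 1
        (fun i => y i - f (x i)))) := by
  have hg : ∀ i, Measurable fun l => F l (x i) - f (x i) := fun i => (hF _).sub_const _
  have := isProbabilityMeasure_tilted_gibbsExponent (π := π)
    (g := fun l i => F l (x i) - f (x i)) hg hR hβ (fun i => y i - f (x i))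
  have hi : Integrable (fun l => F l (x i) - f (x i)) (π.tilted (gibbsExponent
      (fun l i => F l (x i) - f (x i)) β 1 (fun i => y i - f (x i)))) :=
    integrable_of_sum_sq_le (g := fun l i => F l (x i) - f (x i)) hg hR i
  have hagg : aggregate x F π β y (x i) = ∫ l, F l (x i) ∂(π.tilted (gibbsExponent
      (fun l i => F l (x i) - f (x i)) β 1 (fun i => y i - f (x i)))) := by
    rw [integral_tilted, aggregate]
    simp only [weight_eq (f := f) hn, smul_eq_mul]
  have hi' : Integrable (fun l => F l (x i)) (π.tilted (gibbsExponent
      (fun l i => F l (x i) - f (x i)) β 1 (fun i => y i - f (x i)))) := by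
    refine (hi.add (integrable_const (f (x i)))).congr (.of_forall fun l => ?_)
    simp
  rw [hagg, integral_sub hi' (integrable_const _)]
  simp

lemma integrable_weight_mul [IsProbabilityMeasure π] (hn : 1 ≤ n)
    (hF : ∀ z, Measurable fun l => F l z)
    {R : ℝ} (hR : ∀ l, ∑ i, (F l (x i) - f (x i)) ^ 2 ≤ R) (hβ : 0 < β) {C : ℝ}
    (hC : ∀ i l, |F l (x i)| ≤ C) (y : Fin n → ℝ) (i : Fin n) :
    Integrable (fun l => weight x F π β y l * F l (x i)) π := by
  have hg : ∀ i, Measurable fun l => F l (x i) - f (x i) := fun i => (hF _).sub_const _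
  simp only [weight_eq (f := f) hn]
  refine Integrable.mul_bdd (c := C) ?_ (hF _).aestronglyMeasurable (.of_forall (hC i))
  exact (integrable_exp_of_abs_le
    (measurable_gibbsExponent (g := fun l i => F l (x i) - f (x i)) hg _)
    (abs_gibbsExponent_le hR hβ zero_le_one _)).div_const _

end Aggregate

end ExpAgg

/-! ### The oracle inequality. -/

theorem proposition1 {Ω Λ X : Type*} [MeasurableSpace Ω] [MeasurableSpace Λ]
    (P : Measure Ω) [IsProbabilityMeasure P]
    (n : ℕ) (hn : 1 ≤ n)
    (x : Fin n → X) (f : X → ℝ)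
    (F : Λ → X → ℝ) (hF : ∀ z, Measurable fun l => F l z)
    (ξ : Fin n → Ω → ℝ) (σ : ℝ) (hσ : 0 < σ)
    (hindep : iIndepFun ξ P)
    (hlaw : ∀ i, HasLaw (ξ i) (ExpAgg.doubleExp σ) P)
    (Y : Fin n → Ω → ℝ) (hY : ∀ i ω, Y i ω = f (x i) + ξ i ω)
    (L Lbar : ℝ)
    (hL : ∀ l, Real.sqrt (ExpAgg.empSq fun i => f (x i) - F l (x i)) ≤ L)
    (hLbar : ∀ i l, |F l (x i)| ≤ Lbar)
    (π : Measure Λ) [IsProbabilityMeasure π]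
    (β : ℝ)
    (hβ : max ((8 + 4 / (n : ℝ)) * σ ^ 2 + 2 * L ^ 2) (4 * σ * (1 + 1 / (n : ℝ)) * Lbar) < β) :
    -- the aggregate is well defined at the design points, and its loss has an expectation
    (∀ (y : Fin n → ℝ) (i : Fin n),
        Integrable (fun l => ExpAgg.weight x F π β y l * F l (x i)) π) ∧
    Integrable (fun ω => ExpAgg.empSq fun i =>
        ExpAgg.aggregate x F π β (fun j => Y j ω) (x i) - f (x i)) P ∧
    -- the sharp oracle inequality, whose right-hand side may be infinite
    ∀ (p : Measure Λ) [IsProbabilityMeasure p],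
      ENNReal.ofReal (∫ ω, (ExpAgg.empSq fun i =>
          ExpAgg.aggregate x F π β (fun j => Y j ω) (x i) - f (x i)) ∂P) ≤
        ENNReal.ofReal (∫ l, (ExpAgg.empSq fun i => F l (x i) - f (x i)) ∂p) +
          ENNReal.ofReal β * klDiv p π / ((n : ℝ≥0∞) + 1) := by
  have hn0 : (0 : ℝ) < n := by exact_mod_cast hn
  obtain ⟨l0⟩ : Nonempty Λ := nonempty_of_isProbabilityMeasure π
  have hL0 : 0 ≤ L := (Real.sqrt_nonneg _).trans (hL l0)
  obtain ⟨hβ1, hβ2⟩ := max_lt_iff.mp hβ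
  have hβ0 : 0 < β := lt_of_le_of_lt (by positivity) hβ1
  set g : Λ → Fin n → ℝ := fun l i => F l (x i) - f (x i) with hgdef
  have hg : ∀ i, Measurable fun l => g l i := fun i => (hF _).sub_const _
  have hR : ∀ l, ∑ i, g l i ^ 2 ≤ n * L ^ 2 := fun l => by
    have h := (Real.sqrt_le_left hL0).mp (hL l)
    have h' := mul_le_mul_of_nonneg_left h hn0.le
    rw [ExpAgg.natCast_mul_empSq hn] at h'
    refine le_trans (le_of_eq (Finset.sum_congr rfl fun i _ => ?_)) h'
    simp only [hgdef]
    ring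
  -- f cancels in differences, so no sup bound on f enters.
  have hD : ∀ i l l', |g l i - g l' i| ≤ 2 * Lbar := fun i l l' => by
    have h1 : g l i - g l' i = F l (x i) - F l' (x i) := by simp [hgdef]
    rw [h1]
    refine (abs_sub _ _).trans ?_
    have := hLbar i l
    have := hLbar i l'
    linarith
  have := ExpAgg.isProbabilityMeasure_doubleExp hσ
  have hξ : HasLaw (fun ω i => ξ i ω) (Measure.pi fun _ : Fin n => ExpAgg.doubleExp σ) P :=
    hindep.hasLaw_pi hlaw
  set A : (Fin n → ℝ) → ℝ := fun η =>
    ∑ i, (∫ l, g l i ∂(π.tilted (ExpAgg.gibbsExponent g β 1 η))) ^ 2 with hA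
  have hloss : (fun ω => ExpAgg.empSq fun i =>
      ExpAgg.aggregate x F π β (fun j => Y j ω) (x i) - f (x i)) =
      fun ω => 1 / (n : ℝ) * A (fun i => ξ i ω) := by
    ext ω
    have hy : (fun i => Y i ω - f (x i)) = fun i => ξ i ω := by
      ext i
      rw [hY]
      ring
    simp only [ExpAgg.empSq, ExpAgg.aggregate_sub_eq hn hF hR hβ0, hy, hA, hgdef]
  have hAi : Integrable A (Measure.pi fun _ : Fin n => ExpAgg.doubleExp σ) :=
    ExpAgg.integrable_sum_sq_gibbsMean hg hR hβ0
  have hAP : Integrable (fun ω => A (fun i => ξ i ω)) P := by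
    rw [← hξ.map_eq] at hAi
    exact hAi.comp_aemeasurable hξ.aemeasurable
  refine ⟨ExpAgg.integrable_weight_mul hn hF hR hβ0 hLbar, ?_, fun p _ => ?_⟩
  · rw [hloss]
    exact hAP.const_mul _
  · by_cases htop : klDiv p π = ∞
    · have : ENNReal.ofReal β * klDiv p π / ((n : ℝ≥0∞) + 1) = ∞ := by
        rw [htop, ENNReal.mul_top (by simpa using hβ0), ENNReal.top_div_of_ne_top (by simp)]
      rw [this]
      simp
    obtain ⟨hac, hllr⟩ := klDiv_ne_top_iff.mp htop
    -- With γ = 1/n, R = nL² and D = 2`Lbar`, the two conditions on β become the two terms of the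
    -- maximum, and (1/n) · β/(1+1/n) = β/(n+1).
    have hmain := ExpAgg.integral_sum_sq_gibbsMean_le (γ := 1 / n) (π := π) hg hR hD hσ
      (by positivity) hβ0
      (by
        refine le_trans (le_of_eq ?_) hβ2.le
        ring)
      (by
        refine le_trans (le_of_eq ?_) hβ1.le
        field_simp) hac hllr
    have hint : ∫ ω, (ExpAgg.empSq fun i =>
        ExpAgg.aggregate x F π β (fun j => Y j ω) (x i) - f (x i)) ∂P =
        1 / (n : ℝ) * ∫ η, A η ∂(Measure.pi fun _ : Fin n => ExpAgg.doubleExp σ) := by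
      rw [hloss, integral_const_mul, ← hξ.map_eq,
        integral_map hξ.aemeasurable (by rw [hξ.map_eq]; exact hAi.aestronglyMeasurable)]
    have hsum : ∫ l, (ExpAgg.empSq fun i => F l (x i) - f (x i)) ∂p =
        1 / (n : ℝ) * ∫ l, ∑ i, g l i ^ 2 ∂p := by
      simp only [ExpAgg.empSq, integral_const_mul, hgdef]
    have hkl : ENNReal.ofReal β * klDiv p π / ((n : ℝ≥0∞) + 1) =
        ENNReal.ofReal (β * (klDiv p π).toReal / (n + 1)) := by
      rw [ENNReal.ofReal_div_of_pos (by positivity), ENNReal.ofReal_mul hβ0.le,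
        ENNReal.ofReal_toReal htop, ENNReal.ofReal_add hn0.le zero_le_one, ENNReal.ofReal_natCast,
        ENNReal.ofReal_one]
    rw [hint, hsum, hkl, ← ENNReal.ofReal_add
      (mul_nonneg (by positivity) (integral_nonneg fun l => Finset.sum_nonneg fun i _ =>
        sq_nonneg _))
      (div_nonneg (mul_nonneg hβ0.le ENNReal.toReal_nonneg) (by positivity))]
    refine ENNReal.ofReal_le_ofReal ?_
    calc _ ≤ 1 / (n : ℝ) * (∫ l, ∑ i, g l i ^ 2 ∂p + β / (1 + 1 / n) * (klDiv p π).toReal) := by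
          gcongr
      _ = _ := by
          field_simp
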